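/- Fix integers $d \ge 1$ and $p \ge 2$. For an open rectangle $R = (a_1,b_1)\times\cdots\times(a_d,b_d) \subseteq (0,1)^d$ and $1 \le i \le d$, let $H_i(R)$ be the set of the $p$ open rectangles obtained from $R$ by replacing its $i$-th factor $(a_i,b_i)$ by $\big(a_i+\tfrac{j-1}{p}(b_i-a_i),\, a_i+\tfrac{j}{p}(b_i-a_i)\big)$, for $1 \le j \le p$. For $n \ge 1$, a $(d,p,n)$-decomposition of the unit $d$-cube is a set $S_m$ obtained as follows, where $m \ge 0$ is an integer with $n = 1 + m(p-1)$: start from $S_0 = \{(0,1)^d\}$ and, for $k = 1,\dots,m$, choose some $R \in S_{k-1}$ and some $1 \le i \le d$ and put $S_k = (S_{k-1}\setminus\{R\}) \cup H_i(R)$. Let $C_{d,p}(n)$ be the number of distinct $(d,p,n)$-decompositions (it is $0$ if $p-1$ does not divide $n-1$). Theorem. For all integers $d \ge 1$, $p \ge 2$ and $n \ge 1$, the number $C_{d,p}(n)$ is finite and $$C_{d,p}(n) = \frac{1}{n} \sum_{t_1,\ldots,t_d} \left[ \binom{n-1+t_1+\cdots+t_d}{n-1,\,t_1,\,t_2,\,\ldots,\,t_d}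 \prod_{k=1}^d \left( (-1)^{t_k(k+1)} \binom{d}{k}^{t_k} \right) \right],$$ where the sum is over all integers $t_1,\ldots,t_d \ge 0$ such that $\sum_{k=1}^d t_k(p^k-1) = n-1$, and $\binom{N}{n_0,\ldots,n_d} = \frac{N!}{n_0!\cdots n_d!}$ denotes the multinomial coefficient. -/

import Mathlib

namespace CubeDecomposition

/-- The open `d`-rectangle `(a 0, b 0) × ⋯ × (a (d-1), b (d-1))`, as a set of points of `ℝ^d`. -/
def openBox {d : ℕ} (a b : Fin d → ℝ) : Set (Fin d → ℝ) :=
  Set.univ.pi fun k => Set.Ioo (a k) (b k)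

/-- The open unit `d`-cube `(0, 1)^d`. -/
def unitCube (d : ℕ) : Set (Fin d → ℝ) :=
  openBox (fun _ => 0) (fun _ => 1)

/-- The endpoint `c_i(j) = a_i + (j / p) (b_i - a_i)` on the `i`-th coordinate axis. -/
noncomputable def cutPoint {d : ℕ} (p : ℕ) (a b : Fin d → ℝ) (i : Fin d) (j : ℕ) : ℝ :=
  a i + (j : ℝ) / (p : ℝ) * (b i - a i)

/-- The `p`-ary decomposition `H_i(R)` of the box `R` with corners `a`, `b`, orthogonal to the
`i`-th coordinate axis: the `i`-th interval is cut into `p` equal open subintervals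
`(c_i(j), c_i(j+1))`, for `0 ≤ j < p`, and the other intervals are kept. -/
noncomputable def split {d : ℕ} (p : ℕ) (a b : Fin d → ℝ) (i : Fin d) :
    Set (Set (Fin d → ℝ)) :=
  Set.range fun j : Fin p =>
    openBox (Function.update a i (cutPoint p a b i j))
      (Function.update b i (cutPoint p a b i (j + 1)))

/-- `Reachable d p m S`: the set of blocks `S` is obtained from `{(0,1)^d}` by `m` successive
steps, each replacing one block `R` by the blocks of `H_i(R)` for some direction `i`. -/
inductive Reachable (d p : ℕ) : ℕ → Set (Set (Fin d → ℝ)) → Prop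
  | zero : Reachable d p 0 {unitCube d}
  | step {m : ℕ} {S : Set (Set (Fin d → ℝ))} (hS : Reachable d p m S)
      (a b : Fin d → ℝ) (hab : ∀ k, a k < b k) (hR : openBox a b ∈ S) (i : Fin d) :
      Reachable d p (m + 1) ((S \ {openBox a b}) ∪ split p a b i)

/-- The set of all `(d, p, n)`-decompositions of the unit `d`-cube. -/
def decompositions (d p n : ℕ) : Set (Set (Set (Fin d → ℝ))) :=
  {S | ∃ m : ℕ, n = 1 + m * (p - 1) ∧ Reachable d p m S}

/-- `C_{d,p}(n)`: the number of distinct `(d, p, n)`-decompositions. -/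
noncomputable def C (d p n : ℕ) : ℕ :=
  (decompositions d p n).ncard

/-- The tuples `(t_1, …, t_d)` of natural numbers with `∑ t_k (p^k - 1) = n - 1`; the entry
`t_k` is `t i` with `k = i + 1`. The bound `t_k < n` only serves to make this a `Finset`:
by `mem_exponents` it holds automatically. -/
def exponents (d p n : ℕ) : Finset (Fin d → ℕ) :=
  (Fintype.piFinset fun _ : Fin d => Finset.range n).filter fun t =>
    ∑ i : Fin d, t i * (p ^ ((i : ℕ) + 1) - 1) = n - 1

theorem mem_exponents {d p n : ℕ} (hp : 2 ≤ p) (hn : 1 ≤ n) (t : Fin d → ℕ) :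
    t ∈ exponents d p n ↔ ∑ i : Fin d, t i * (p ^ ((i : ℕ) + 1) - 1) = n - 1 := by
  simp only [exponents, Finset.mem_filter, Fintype.mem_piFinset, Finset.mem_range,
    and_iff_right_iff_imp]
  intro h i
  have h1 : t i * (p ^ ((i : ℕ) + 1) - 1) ≤ n - 1 := by
    rw [← h]
    exact Finset.single_le_sum (f := fun i : Fin d => t i * (p ^ ((i : ℕ) + 1) - 1))
      (fun _ _ => Nat.zero_le _) (Finset.mem_univ i)
  have h2 : 1 < p ^ ((i : ℕ) + 1) := Nat.one_lt_pow (Nat.succ_ne_zero _) (by omega)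
  have h3 : t i * 1 ≤ t i * (p ^ ((i : ℕ) + 1) - 1) := Nat.mul_le_mul_left _ (by omega)
  omega

end CubeDecomposition

/-! Different sequences of cuts can give the same decomposition, so counting cut sequences or trees
overcounts. Read top-down, a nontrivial decomposition is a gluing of `p` rescaled decompositions
along some direction `i`, and the possible `i` are exactly those for which every block lies in a
slab orthogonal to the `i`-th axis (`Dec.exists_eq_glue`). Cuts in different directions commute, so
the decompositions admitting every direction of `I` as a first cut are grids of `p ^ |I|` arbitrary
decompositions. If `F` is the generating function, theirs is `F ^ p ^ |I|`
(`mk_ncard_compatibleDecs`). Inclusion-exclusion over `I`, with the trivial decomposition apart,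
gives `F = X + ∑ c_k F ^ p ^ k`, where `c_k = (-1) ^ (k + 1) * choose d k` (`genFun_eq`).

Hence `F` is the compositional inverse of `X * w` with `w = 1 - ∑ c_k X ^ (p ^ k - 1)`. Lagrange
inversion (`lagrange_inversion`) says that `n` times the `n`-th coefficient of `F` is the
coefficient of `X ^ (n - 1)` in `w ^ (-n)`. The negative binomial series and the multinomial theorem
expand the latter into the stated sum. -/

namespace CubeDecomposition

open Function

/-! ### Slabs, contractions and gluing -/

/-- The affine map of `ℝ^d` sending the unit cube onto the `j`-th of its `p` slabs orthogonal to
the `i`-th coordinate axis. -/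
noncomputable def contract {d : ℕ} (p : ℕ) (i : Fin d) (j : ℕ) (x : Fin d → ℝ) : Fin d → ℝ :=
  update x i ((j + x i) / p)

/-- The `j`-th slab of width `1 / p` orthogonal to the `i`-th coordinate axis. -/
def slab {d : ℕ} (p : ℕ) (i : Fin d) (j : ℕ) : Set (Fin d → ℝ) :=
  {x | (j : ℝ) < p * x i ∧ p * x i < j + 1}

/-- The set of blocks obtained by placing a scaled copy of `T j` in the `j`-th slab. -/
def glue {d : ℕ} (p : ℕ) (i : Fin d) (T : Fin p → Set (Set (Fin d → ℝ))) :
    Set (Set (Fin d → ℝ)) :=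
  ⋃ j : Fin p, Set.image (contract p i j) '' T j

/-- Every block is a nonempty subset of the unit cube. -/
def Proper {d : ℕ} (S : Set (Set (Fin d → ℝ))) : Prop :=
  ∀ B ∈ S, B.Nonempty ∧ B ⊆ unitCube d

/-- Every block lies in one of the slabs orthogonal to the `i`-th axis. -/
def Compatible {d : ℕ} (p : ℕ) (i : Fin d) (S : Set (Set (Fin d → ℝ))) : Prop :=
  ∀ B ∈ S, ∃ j : ℕ, B ⊆ slab p i j

variable {d p : ℕ} {i k : Fin d} {S S' : Set (Set (Fin d → ℝ))}

theorem mem_openBox {a b x : Fin d → ℝ} : x ∈ openBox a b ↔ ∀ k, a k < x k ∧ x k < b k := by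
  simp [openBox, Set.mem_pi]

theorem contract_injective (hp : 2 ≤ p) (i : Fin d) (j : ℕ) : Injective (contract p i j) := by
  have hp' : (p : ℝ) ≠ 0 := by positivity
  intro x y h
  funext k
  have h2 := congrFun h k
  by_cases hk : k = i
  · subst hk
    simpa [contract, div_left_inj' hp'] using h2
  · simpa [contract, hk] using h2

theorem contract_comm (hik : i ≠ k) (j l : ℕ) (x : Fin d → ℝ) :
    contract p i j (contract p k l x) = contract p k l (contract p i j x) := by
  simp [contract, hik, hik.symm, update_comm hik]

theorem exists_contract_eq (hp : 2 ≤ p) (i : Fin d) (j : ℕ) (x : Fin d → ℝ) :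
    ∃ y, contract p i j y = x := by
  have hp' : (p : ℝ) ≠ 0 := by positivity
  refine ⟨update x i (p * x i - j), ?_⟩
  simp [contract, hp']

theorem contract_lt_contract (hp : 2 ≤ p) (j : ℕ) {x y : Fin d → ℝ} {k : Fin d} :
    contract p i j x k < contract p i j y k ↔ x k < y k := by
  have hp' : (0 : ℝ) < p := by positivity
  by_cases hk : k = i
  · subst hk
    simp [contract, div_lt_div_iff_of_pos_right hp']
  · simp [contract, hk]

theorem image_contract_openBox (hp : 2 ≤ p) (j : ℕ) (a b : Fin d → ℝ) :
    contract p i j '' openBox a b = openBox (contract p i j a) (contract p i j b) := by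
  ext x
  obtain ⟨y, rfl⟩ := exists_contract_eq hp i j x
  simp only [(contract_injective hp i j).mem_set_image, mem_openBox, contract_lt_contract hp]

theorem mem_slab_contract {j l : ℕ} {x : Fin d → ℝ} (hik : i ≠ k) :
    contract p i j x ∈ slab p k l ↔ x ∈ slab p k l := by
  simp [contract, slab, hik.symm]

theorem contract_mem_slab (hp : 2 ≤ p) (j : ℕ) {x : Fin d → ℝ} (hx : x ∈ unitCube d) :
    contract p i j x ∈ slab p i j := by
  have hp' : (p : ℝ) ≠ 0 := by positivity
  have := mem_openBox.1 hx i
  simp only [contract, slab, update_self, Set.mem_ofPred_eq, mul_div_cancel₀ _ hp']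
  constructor <;> linarith [this.1, this.2]

theorem contract_mem_unitCube (hp : 2 ≤ p) {j : ℕ} (hj : j < p) {x : Fin d → ℝ}
    (hx : x ∈ unitCube d) : contract p i j x ∈ unitCube d := by
  have hp' : (0 : ℝ) < p := by positivity
  have hj' : (j : ℝ) + 1 ≤ p := by exact_mod_cast hj
  refine mem_openBox.2 fun k => ?_
  have := mem_openBox.1 hx k
  by_cases hk : k = i
  · subst hk
    simp only [contract, update_self]
    rw [div_lt_one hp', div_pos_iff_of_pos_right hp']
    have : (0 : ℝ) ≤ j := by positivity
    constructor <;> linarith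
  · simpa [contract, hk] using this

theorem slab_unique {j l : ℕ} {x : Fin d → ℝ} (hj : x ∈ slab p i j) (hl : x ∈ slab p i l) :
    j = l := by
  have h1 : (j : ℝ) < l + 1 := hj.1.trans hl.2
  have h2 : (l : ℝ) < j + 1 := hl.1.trans hj.2
  have h1 : j < l + 1 := by exact_mod_cast h1
  have h2 : l < j + 1 := by exact_mod_cast h2
  omega

theorem unitCube_nonempty (d : ℕ) : (unitCube d).Nonempty :=
  ⟨fun _ => 1 / 2, mem_openBox.2 fun _ => by norm_num⟩

theorem proper_unitCube (d : ℕ) : Proper {unitCube d} := by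
  rintro B rfl
  exact ⟨unitCube_nonempty d, subset_rfl⟩

theorem not_compatible_unitCube (hp : 2 ≤ p) (i : Fin d) : ¬ Compatible p i {unitCube d} := by
  have hp' : (1 : ℝ) < p := by exact_mod_cast hp
  intro h
  obtain ⟨j, hj⟩ := h _ rfl
  -- This point lies on the boundary between the slabs 0 and 1, hence in no open slab, yet it is in
  -- the cube because `1 < p`.
  have hx : (fun _ => 1 / (p : ℝ)) ∈ unitCube d :=
    mem_openBox.2 fun _ => ⟨by positivity, by rw [div_lt_one] <;> linarith⟩
  obtain ⟨h1, h2⟩ := hj hx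
  rw [mul_one_div_cancel (by positivity)] at h1 h2
  have h1 : j < 1 := by exact_mod_cast h1
  have h2 : 1 < j + 1 := by exact_mod_cast h2
  omega

section glue

variable {T T' : Fin p → Set (Set (Fin d → ℝ))}

theorem mem_glue {B : Set (Fin d → ℝ)} :
    B ∈ glue p i T ↔ ∃ j : Fin p, ∃ B' ∈ T j, contract p i j '' B' = B := by
  simp [glue]

theorem Proper.glue (hp : 2 ≤ p) (hT : ∀ j, Proper (T j)) : Proper (glue p i T) := by
  intro B hB
  obtain ⟨j, B, hB', rfl⟩ := mem_glue.1 hB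
  obtain ⟨h1, h2⟩ := hT j B hB'
  refine ⟨h1.image _, ?_⟩
  rintro _ ⟨x, hx, rfl⟩
  exact contract_mem_unitCube hp j.2 (h2 hx)

/-- Blocks lying in different slabs are different. -/
theorem image_contract_inj (hp : 2 ≤ p) {j l : ℕ} {B B' : Set (Fin d → ℝ)}
    (hB : B.Nonempty ∧ B ⊆ unitCube d) (hB' : B' ⊆ unitCube d)
    (h : contract p i j '' B = contract p i l '' B') : j = l ∧ B = B' := by
  obtain ⟨x, hx⟩ := hB.1
  obtain ⟨y, hy, hxy⟩ : contract p i j x ∈ contract p i l '' B' := h ▸ ⟨x, hx, rfl⟩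
  have h1 := contract_mem_slab (i := i) hp j (hB.2 hx)
  have h2 := contract_mem_slab (i := i) hp l (hB' hy)
  obtain rfl := slab_unique h1 (hxy ▸ h2)
  exact ⟨rfl, (contract_injective hp i j).image_injective h⟩

theorem image_contract_mem_glue (hp : 2 ≤ p) (hT : ∀ j, Proper (T j)) {j : Fin p}
    {B : Set (Fin d → ℝ)} (hB : B.Nonempty ∧ B ⊆ unitCube d) :
    contract p i j '' B ∈ CubeDecomposition.glue p i T ↔ B ∈ T j := by
  rw [mem_glue]
  constructor
  · rintro ⟨l, B', hB', h⟩
    obtain ⟨h1, rfl⟩ := image_contract_inj hp (hT l _ hB') hB.2 h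
    obtain rfl := Fin.ext h1
    exact hB'
  · exact fun h => ⟨j, B, h, rfl⟩

/-- A block determines its slab, so each part can be read off from the gluing. Properness is
essential: an empty block would have the same image in every slab. -/
theorem glue_injective (hp : 2 ≤ p) (hT : ∀ j, Proper (T j)) (hT' : ∀ j, Proper (T' j))
    (h : CubeDecomposition.glue p i T = CubeDecomposition.glue p i T') : T = T' := by
  funext j
  ext B
  constructor <;> intro hB
  · have h1 := hT j B hB
    rwa [← image_contract_mem_glue hp hT h1, h, image_contract_mem_glue hp hT' h1] at hB
  · have h1 := hT' j B hB
    rwa [← image_contract_mem_glue hp hT' h1, ← h, image_contract_mem_glue hp hT h1] at hB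

theorem ncard_glue (hp : 2 ≤ p) (hT : ∀ j, Proper (T j)) (hf : ∀ j, (T j).Finite) :
    (CubeDecomposition.glue p i T).ncard = ∑ j, (T j).ncard := by
  rw [CubeDecomposition.glue, Set.ncard_iUnion_of_finite, finsum_eq_sum_of_fintype]
  · exact Finset.sum_congr rfl fun j _ =>
      Set.ncard_image_of_injective _ (contract_injective hp i j).image_injective
  · exact fun j => (hf j).image _
  · intro j l hjl
    refine Set.disjoint_left.2 ?_
    rintro _ ⟨B, hB, rfl⟩ ⟨B', hB', h⟩
    exact hjl (Fin.ext (image_contract_inj hp (hT l _ hB') (hT j _ hB).2 h).1.symm)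

/-- Contractions along different axes commute, so a `p × p` grid of parts may be cut in either
order. This is the source of the overcounting. -/
theorem glue_comm (hik : i ≠ k) (U : Fin p → Fin p → Set (Set (Fin d → ℝ))) :
    CubeDecomposition.glue p k (fun j => CubeDecomposition.glue p i fun l => U j l) =
      CubeDecomposition.glue p i (fun l => CubeDecomposition.glue p k fun j => U j l) := by
  simp only [CubeDecomposition.glue, Set.image_iUnion, Set.image_image]
  rw [Set.iUnion_comm]
  simp only [contract_comm hik]

theorem compatible_glue_self (hp : 2 ≤ p) (hT : ∀ j, Proper (T j)) :
    Compatible p i (CubeDecomposition.glue p i T) := by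
  intro B hB
  obtain ⟨j, B, hB', rfl⟩ := mem_glue.1 hB
  refine ⟨j, ?_⟩
  rintro _ ⟨x, hx, rfl⟩
  exact contract_mem_slab hp j ((hT j B hB').2 hx)

/-- A contraction along the `i`-th axis leaves the `k`-th coordinate alone. -/
theorem compatible_glue (hik : i ≠ k) :
    Compatible p k (CubeDecomposition.glue p i T) ↔ ∀ j, Compatible p k (T j) := by
  constructor
  · intro h j B hB
    obtain ⟨l, hl⟩ := h _ (mem_glue.2 ⟨j, B, hB, rfl⟩)
    exact ⟨l, fun x hx => (mem_slab_contract hik).1 (hl ⟨x, hx, rfl⟩)⟩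
  · intro h B hB
    obtain ⟨j, B, hB', rfl⟩ := mem_glue.1 hB
    obtain ⟨l, hl⟩ := h j B hB'
    refine ⟨l, ?_⟩
    rintro _ ⟨x, hx, rfl⟩
    exact (mem_slab_contract hik).2 (hl hx)

end glue

/-! ### Top-down description of decompositions -/

/-- `Dec d p m S`: top-down description of the decompositions obtained by `m` steps. Either `S` is
trivial, or it is glued from decompositions of the `p` slabs in some direction. -/
inductive Dec (d p : ℕ) : ℕ → Set (Set (Fin d → ℝ)) → Prop
  | leaf : Dec d p 0 {unitCube d}
  | node (i : Fin d) (ν : Fin p → ℕ) (T : Fin p → Set (Set (Fin d → ℝ)))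
      (hT : ∀ j, Dec d p (ν j) (T j)) : Dec d p (∑ j, ν j + 1) (glue p i T)

theorem Dec.proper (hp : 2 ≤ p) {m : ℕ} (h : Dec d p m S) : Proper S := by
  induction h with
  | leaf => exact proper_unitCube d
  | node i ν T _ ih => exact Proper.glue hp ih

theorem Dec.finite {m : ℕ} (h : Dec d p m S) : S.Finite := by
  induction h with
  | leaf => exact Set.finite_singleton _
  | node i ν T _ ih => exact Set.finite_iUnion fun j => (ih j).image _

/-- Each cut replaces one block by `p`. Thus the number of cuts is determined by the number of
blocks, and counting can be done by the latter. -/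
theorem Dec.ncard (hp : 2 ≤ p) {m : ℕ} (h : Dec d p m S) : S.ncard = 1 + m * (p - 1) := by
  induction h with
  | leaf => simp
  | node i ν T hT ih =>
    rw [ncard_glue hp (fun j => (hT j).proper hp) fun j => (hT j).finite]
    simp only [ih, Finset.sum_add_distrib, ← Finset.sum_mul]
    simp only [Finset.sum_const, Finset.card_univ, Fintype.card_fin, smul_eq_mul]
    obtain ⟨q, rfl⟩ : ∃ q, p = q + 1 := ⟨p - 1, by omega⟩
    simp only [Nat.add_sub_cancel]
    ring

/-- A decomposition each of whose blocks lies in a slab orthogonal to the `i`-th axis can be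
obtained by splitting first in direction `i`. -/
theorem Dec.exists_eq_glue (hp : 2 ≤ p) {m : ℕ} (h : Dec d p m S) (hS : Compatible p i S) :
    ∃ T : Fin p → Set (Set (Fin d → ℝ)), (∀ j, ∃ m, Dec d p m (T j)) ∧ S = glue p i T := by
  induction h with
  | leaf => exact absurd hS (not_compatible_unitCube hp i)
  | node k ν T hT ih =>
    by_cases hik : i = k
    · subst hik
      exact ⟨T, fun j => ⟨_, hT j⟩, rfl⟩
    -- The first cut is in another direction `k`. Every part is still compatible with `i`, so by
    -- induction it can be cut first in direction `i`; exchanging the two levels of cuts brings `i`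
    -- to the top.
    · rw [compatible_glue (Ne.symm hik)] at hS
      choose U hU hTU using fun j => ih j (hS j)
      choose μ hμ using hU
      refine ⟨fun l => glue p k fun j => U j l, fun l => ⟨_, .node k _ _ fun j => hμ j l⟩, ?_⟩
      rw [← glue_comm hik, funext hTU]

/-! ### Equivalence of successive cuts with the top-down description -/

/-- The relation of one step: replace one block of `S` by the blocks of one of its `p`-ary decompositions. -/
def Step (p : ℕ) (S S' : Set (Set (Fin d → ℝ))) : Prop :=
  ∃ a b : Fin d → ℝ, (∀ k, a k < b k) ∧ openBox a b ∈ S ∧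
    ∃ i, S' = (S \ {openBox a b}) ∪ split p a b i

/-- Contractions are affine in each coordinate, so they preserve the division of an interval into
`p` equal parts. -/
theorem image_split (hp : 2 ≤ p) (j : ℕ) (a b : Fin d → ℝ) :
    Set.image (contract p i j) '' split p a b k =
      split p (contract p i j a) (contract p i j b) k := by
  have key : ∀ (c : Fin d → ℝ) (l : ℕ), contract p i j (update c k (cutPoint p a b k l)) =
      update (contract p i j c) k
        (cutPoint p (contract p i j a) (contract p i j b) k l) := by
    intro c l
    by_cases hik : i = k
    · subst hik
      simp only [contract, cutPoint, update_idem, update_self]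
      congr 1
      ring
    · simp only [contract, cutPoint]
      rw [update_comm hik]
      simp [hik, Ne.symm hik]
  simp only [split, ← Set.range_comp]
  congr 1
  funext l
  simp only [comp_apply, image_contract_openBox hp, key]

theorem split_unitCube (hp : 2 ≤ p) (i : Fin d) :
    split p (fun _ => 0) (fun _ => 1) i = glue p i fun _ => {unitCube d} := by
  ext B
  simp only [split, Set.mem_range, mem_glue, Set.mem_singleton_iff, exists_eq_left]
  refine exists_congr fun j => ?_
  rw [unitCube, image_contract_openBox hp]
  simp [contract, cutPoint]

/-- Steps refer to corners whereas blocks are sets. The corners of a nonempty box are recovered as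
infima and suprema of its projections. -/
theorem openBox_eq_unitCube {a b : Fin d → ℝ} (hab : ∀ k, a k < b k)
    (h : openBox a b = unitCube d) : a = (fun _ => 0) ∧ b = fun _ => 1 := by
  have key : ∀ k, Set.Ioo (a k) (b k) = Set.Ioo 0 1 := by
    intro k
    have h1 : eval k '' openBox a b = Set.Ioo (a k) (b k) :=
      Set.eval_image_univ_pi (Set.univ_pi_nonempty_iff.2 fun k => Set.nonempty_Ioo.2 (hab k))
    have h2 : eval k '' unitCube d = Set.Ioo 0 1 :=
      Set.eval_image_univ_pi (t := fun _ => Set.Ioo (0 : ℝ) 1)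
        (Set.univ_pi_nonempty_iff.2 fun k => Set.nonempty_Ioo.2 zero_lt_one)
    rw [← h1, h, h2]
  constructor <;> funext k
  · rw [← csInf_Ioo (hab k), key, csInf_Ioo zero_lt_one]
  · rw [← csSup_Ioo (hab k), key, csSup_Ioo zero_lt_one]

theorem glue_update_step (hp : 2 ≤ p) {T : Fin p → Set (Set (Fin d → ℝ))}
    (hT : ∀ j, Proper (T j)) {j : Fin p} {a b : Fin d → ℝ} (hR : openBox a b ∈ T j)
    (i k : Fin d) :
    glue p i (update T j ((T j \ {openBox a b}) ∪ split p a b k)) =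
      (glue p i T \ {openBox (contract p i j a) (contract p i j b)}) ∪
        split p (contract p i j a) (contract p i j b) k := by
  rw [← image_contract_openBox hp, ← image_split hp]
  ext B
  simp only [Set.mem_union, Set.mem_sdiff, mem_glue, Set.mem_singleton_iff]
  constructor
  · rintro ⟨l, B, hB, rfl⟩
    by_cases hl : l = j
    · subst hl
      rw [update_self] at hB
      rcases hB with ⟨hB, hne⟩ | hB
      · exact .inl ⟨⟨l, B, hB, rfl⟩,
          fun h => hne ((contract_injective hp i l).image_injective h)⟩
      · exact .inr ⟨B, hB, rfl⟩
    · rw [update_of_ne hl] at hB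
      refine .inl ⟨⟨l, B, hB, rfl⟩, fun h => hl (Fin.ext ?_)⟩
      exact (image_contract_inj hp (hT l _ hB) (hT j _ hR).2 h).1
  · rintro (⟨⟨l, B, hB, rfl⟩, hne⟩ | ⟨B, hB, rfl⟩)
    · refine ⟨l, B, ?_, rfl⟩
      by_cases hl : l = j
      · subst hl
        rw [update_self]
        exact .inl ⟨hB, fun h => hne (by rw [Set.mem_singleton_iff.1 h])⟩
      · rwa [update_of_ne hl]
    · exact ⟨j, B, by rw [update_self]; exact .inr hB, rfl⟩

theorem Step.glue (hp : 2 ≤ p) {T : Fin p → Set (Set (Fin d → ℝ))} (hT : ∀ j, Proper (T j))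
    {j : Fin p} {T' : Set (Set (Fin d → ℝ))} (h : Step p (T j) T') (i : Fin d) :
    Step p (glue p i T) (glue p i (update T j T')) := by
  obtain ⟨a, b, hab, hR, k, rfl⟩ := h
  refine ⟨contract p i j a, contract p i j b, fun k => (contract_lt_contract hp j).2 (hab k), ?_,
    k, glue_update_step hp hT hR i k⟩
  rw [← image_contract_openBox hp]
  exact mem_glue.2 ⟨j, _, hR, rfl⟩

/-- A step on a glued set of blocks is a step on one of its parts. -/
theorem Step.of_glue (hp : 2 ≤ p) {T : Fin p → Set (Set (Fin d → ℝ))} (hT : ∀ j, Proper (T j))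
    (h : Step p (CubeDecomposition.glue p i T) S') :
    ∃ j T', Step p (T j) T' ∧ S' = CubeDecomposition.glue p i (update T j T') := by
  obtain ⟨a, b, hab, hR, k, rfl⟩ := h
  obtain ⟨j, B, hB, h⟩ := mem_glue.1 hR
  obtain ⟨a, rfl⟩ := exists_contract_eq hp i j a
  obtain ⟨b, rfl⟩ := exists_contract_eq hp i j b
  rw [← image_contract_openBox hp] at h
  obtain rfl := (contract_injective hp i j).image_injective h
  exact ⟨j, _, ⟨a, b, fun k => (contract_lt_contract hp j).1 (hab k), hB, k, rfl⟩,
    (glue_update_step hp hT hB i k).symm⟩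

theorem dec_split (i : Fin d) : Dec d p 1 (glue p i fun _ => {unitCube d}) := by
  simpa using Dec.node (p := p) i (fun _ => 0) (fun _ => {unitCube d}) fun _ => .leaf

theorem sum_update_succ (ν : Fin p → ℕ) (j : Fin p) :
    ∑ l, update ν j (ν j + 1) l = ∑ l, ν l + 1 := by
  rw [Finset.sum_update_of_mem (Finset.mem_univ j),
    ← Finset.add_sum_erase _ ν (Finset.mem_univ j), Finset.sdiff_singleton_eq_erase]
  ring

theorem Dec.update {ν : Fin p → ℕ} {T : Fin p → Set (Set (Fin d → ℝ))}
    (hT : ∀ j, Dec d p (ν j) (T j)) {j : Fin p} {n : ℕ} {T' : Set (Set (Fin d → ℝ))}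
    (h : Dec d p n T') (l : Fin p) : Dec d p (update ν j n l) (update T j T' l) := by
  by_cases hl : l = j
  · subst hl
    simpa using h
  · simpa [hl] using hT l

theorem Dec.step (hp : 2 ≤ p) {m : ℕ} (h : Dec d p m S) (hS : Step p S S') :
    Dec d p (m + 1) S' := by
  induction h generalizing S' with
  | leaf =>
    obtain ⟨a, b, hab, hR, i, rfl⟩ := hS
    obtain ⟨rfl, rfl⟩ := openBox_eq_unitCube hab hR
    rw [hR, sdiff_self, Set.bot_eq_empty, Set.empty_union, split_unitCube hp]
    exact dec_split i
  | node i ν T hT ih =>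
    obtain ⟨j, T', hT', rfl⟩ := hS.of_glue hp fun j => (hT j).proper hp
    rw [← sum_update_succ ν j]
    exact .node i _ _ fun l => Dec.update hT (ih j hT') l

theorem Dec.eq_unitCube (h : Dec d p 0 S) : S = {unitCube d} := by
  generalize hn : 0 = n at h
  cases h with
  | leaf => rfl
  | node => omega

/-- Some node of the tree has only leaves below it; its cut can be taken as the last one. The
recursion descends into a nontrivial part as long as there is one. -/
theorem Dec.exists_step (hp : 2 ≤ p) {n : ℕ} (h : Dec d p n S) (hn : n ≠ 0) :
    ∃ m S', n = m + 1 ∧ Dec d p m S' ∧ Step p S' S := by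
  induction h with
  | leaf => exact absurd rfl hn
  | node i ν T hT ih =>
    by_cases h0 : ∃ j, ν j ≠ 0
    · obtain ⟨j, hj⟩ := h0
      obtain ⟨m, T', hm, hT', hs⟩ := ih j hj
      have hdec := Dec.update hT (j := j) hT'
      have hs' : Step p (Function.update T j T' j) (T j) := by rwa [update_self]
      refine ⟨∑ l, Function.update ν j m l + 1, _, ?_, .node i _ _ hdec, ?_⟩
      · rw [← sum_update_succ (Function.update ν j m) j, update_self, update_idem, ← hm,
          update_eq_self]
      · simpa using hs'.glue hp (fun l => (hdec l).proper hp) i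
    · push Not at h0
      obtain rfl : ν = fun _ => 0 := funext h0
      have hT0 : T = fun _ => {unitCube d} := by
        exact funext fun j => (hT j).eq_unitCube
      subst hT0
      refine ⟨0, _, by simp, .leaf, fun _ => 0, fun _ => 1, fun _ => zero_lt_one, rfl, i, ?_⟩
      rw [split_unitCube hp, unitCube, sdiff_self, Set.bot_eq_empty, Set.empty_union]

theorem reachable_iff_dec (hp : 2 ≤ p) {m : ℕ} : Reachable d p m S ↔ Dec d p m S := by
  constructor
  · intro h
    induction h with
    | zero => exact .leaf
    | step _ a b hab hR i ih => exact ih.step hp ⟨a, b, hab, hR, i, rfl⟩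
  · intro h
    induction m generalizing S with
    | zero =>
      rw [h.eq_unitCube]
      exact .zero
    | succ m ih =>
      obtain ⟨m', S', hm, hS', a, b, hab, hR, i, rfl⟩ := h.exists_step hp m.succ_ne_zero
      obtain rfl : m = m' := by omega
      exact .step (ih hS') a b hab hR i

/-! ### Counting decompositions with prescribed possible first cuts -/

theorem ncard_univ_pi {ι : Type*} [Fintype ι] {α : ι → Type*} (s : ∀ i, Set (α i)) :
    (Set.univ.pi s).ncard = ∏ i, (s i).ncard := by
  simp only [Set.ncard, Set.encard_pi_eq_prod_encard]
  exact map_prod ENat.toNatHom _ _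

/-- The `(d, p, n)`-decompositions that can be split first in each of the directions in `I`. -/
def compatibleDecs (d p : ℕ) (I : Finset (Fin d)) (n : ℕ) : Set (Set (Set (Fin d → ℝ))) :=
  {S | (∃ m, Dec d p m S) ∧ (∀ i ∈ I, Compatible p i S) ∧ S.ncard = n}

variable {I : Finset (Fin d)}

theorem decompositions_eq (hp : 2 ≤ p) (n : ℕ) :
    decompositions d p n = compatibleDecs d p ∅ n := by
  ext S
  simp only [decompositions, compatibleDecs, Set.mem_ofPred_eq, reachable_iff_dec hp,
    Finset.notMem_empty, false_imp_iff, implies_true, true_and]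
  constructor
  · rintro ⟨m, hn, h⟩
    exact ⟨⟨m, h⟩, (h.ncard hp).trans hn.symm⟩
  · rintro ⟨⟨m, h⟩, hn⟩
    exact ⟨m, hn.symm.trans (h.ncard hp), h⟩

/-- Cut first in direction `i`: block counts add up over the parts, and compatibility with the
directions of `I` is inherited by each part. The index set `finsuppAntidiag` is the one in
`PowerSeries.coeff_prod`. -/
theorem compatibleDecs_insert (hp : 2 ≤ p) (hi : i ∉ I) (n : ℕ) :
    compatibleDecs d p (insert i I) n = glue p i ''
      ⋃ ν ∈ (Finset.univ.finsuppAntidiag n : Finset (Fin p →₀ ℕ)),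
        Set.univ.pi fun j => compatibleDecs d p I (ν j) := by
  ext S
  simp only [compatibleDecs, Set.mem_ofPred_eq, Set.mem_image, Set.mem_iUnion, Set.mem_univ_pi,
    Finset.mem_insert, forall_eq_or_imp, exists_prop, Finset.mem_finsuppAntidiag]
  have hne : ∀ k ∈ I, i ≠ k := fun k hk h => hi (h ▸ hk)
  constructor
  · rintro ⟨⟨m, h⟩, ⟨hiS, hI⟩, hn⟩
    obtain ⟨T, hT, rfl⟩ := h.exists_eq_glue hp hiS
    choose μ hμ using hT
    refine ⟨T, ⟨Finsupp.equivFunOnFinite.symm fun j => (T j).ncard, ⟨?_, by simp⟩, fun j =>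
      ⟨⟨_, hμ j⟩, fun k hk => (compatible_glue (hne k hk)).1 (hI k hk) j, rfl⟩⟩, rfl⟩
    rw [← hn, ncard_glue hp (fun j => (hμ j).proper hp) fun j => (hμ j).finite]
    rfl
  · rintro ⟨T, ⟨ν, ⟨hν, -⟩, hT⟩, rfl⟩
    choose μ hμ using fun j => (hT j).1
    refine ⟨⟨_, .node i _ _ hμ⟩, ⟨compatible_glue_self hp fun j => (hμ j).proper hp,
      fun k hk => (compatible_glue (hne k hk)).2 fun j => (hT j).2.1 k hk⟩, ?_⟩
    rw [ncard_glue hp (fun j => (hμ j).proper hp) fun j => (hμ j).finite, ← hν]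
    exact Finset.sum_congr rfl fun j _ => (hT j).2.2

theorem Dec.one_le_ncard (hp : 2 ≤ p) {m : ℕ} {S : Set (Set (Fin d → ℝ))} (h : Dec d p m S) :
    1 ≤ S.ncard := by
  rw [h.ncard hp]
  omega

/-- A nontrivial decomposition can be split first in some direction. -/
theorem compatibleDecs_empty_subset (hp : 2 ≤ p) (n : ℕ) :
    compatibleDecs d p ∅ n ⊆ {{unitCube d}} ∪ ⋃ i, compatibleDecs d p {i} n := by
  rintro S ⟨⟨m, h⟩, -, hn⟩
  cases h with
  | leaf => exact .inl rfl
  | node i ν T hT =>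
    refine .inr (Set.mem_iUnion.2 ⟨i, ⟨_, .node i ν T hT⟩, ?_, hn⟩)
    simpa using compatible_glue_self hp fun j => (hT j).proper hp

theorem compatibleDecs_mono {J : Finset (Fin d)} (h : I ⊆ J) (n : ℕ) :
    compatibleDecs d p J n ⊆ compatibleDecs d p I n :=
  fun _ hS => ⟨hS.1, fun i hi => hS.2.1 i (h hi), hS.2.2⟩

theorem compatibleDecs_finite (hp : 2 ≤ p) (I : Finset (Fin d)) (n : ℕ) :
    (compatibleDecs d p I n).Finite := by
  suffices h : (compatibleDecs d p ∅ n).Finite from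
    h.subset (compatibleDecs_mono (Finset.empty_subset I) n)
  clear I
  induction n using Nat.strong_induction_on with
  | _ n ih =>
    refine Set.Finite.subset ((Set.finite_singleton _).union (Set.finite_iUnion fun i => ?_))
      (compatibleDecs_empty_subset hp n)
    rw [← insert_empty_eq, compatibleDecs_insert hp (Finset.notMem_empty i)]
    refine .image _ (.biUnion (Finset.finite_toSet _) fun ν hν => ?_)
    have hsum : ∑ j, ν j = n := (Finset.mem_finsuppAntidiag.1 hν).1
    -- If all parts are nonempty then, as `p ≥ 2`, each has fewer than `n` blocks and induction
    -- applies. Otherwise some `ν j = 0`, and no decomposition has zero blocks.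
    by_cases h0 : ∀ j, 1 ≤ ν j
    · refine Set.Finite.pi fun j => ih _ ?_
      have : Nontrivial (Fin p) := Fin.nontrivial_iff_two_le.2 hp
      obtain ⟨l, hl⟩ := exists_ne j
      rw [← hsum, ← Finset.add_sum_erase _ _ (Finset.mem_univ j)]
      have := Finset.single_le_sum (f := fun l => ν l) (fun _ _ => Nat.zero_le _)
        (Finset.mem_erase.2 ⟨hl, Finset.mem_univ l⟩)
      have := h0 l
      omega
    · push Not at h0
      obtain ⟨j, hj⟩ := h0
      convert Set.finite_empty
      refine Set.eq_empty_of_forall_notMem fun T hT => ?_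
      obtain ⟨⟨m, h⟩, -, h2⟩ := hT j (Set.mem_univ j)
      have := h.one_le_ncard hp
      omega

theorem ncard_compatibleDecs_insert (hp : 2 ≤ p) (hi : i ∉ I) (n : ℕ) :
    (compatibleDecs d p (insert i I) n).ncard =
      ∑ ν ∈ (Finset.univ.finsuppAntidiag n : Finset (Fin p →₀ ℕ)),
        ∏ j, (compatibleDecs d p I (ν j)).ncard := by
  rw [compatibleDecs_insert hp hi, Set.InjOn.ncard_image, ← Finset.sum_congr rfl fun ν _ =>
    ncard_univ_pi _]
  · refine Eq.trans (Set.Finite.ncard_biUnion (Finset.finite_toSet _) ?_ ?_)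
      (finsum_mem_coe_finset _ _)
    · exact fun ν _ => Set.Finite.pi fun j => compatibleDecs_finite hp I _
    · intro ν _ μ _ hνμ
      refine Set.disjoint_left.2 fun T hT hT' => hνμ (Finsupp.ext fun j => ?_)
      exact (hT j (Set.mem_univ j)).2.2.symm.trans (hT' j (Set.mem_univ j)).2.2
  · intro T hT T' hT' h
    simp only [Set.mem_iUnion, Set.mem_univ_pi] at hT hT'
    obtain ⟨ν, _, hT⟩ := hT
    obtain ⟨μ, _, hT'⟩ := hT'
    exact glue_injective hp (fun j => (hT j).1.elim fun _ h => h.proper hp)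
      (fun j => (hT' j).1.elim fun _ h => h.proper hp) h

/-! ### The functional equation -/

/-- The generating function of the number of `(d, p, n)`-decompositions. -/
noncomputable def genFun (d p : ℕ) : PowerSeries ℚ :=
  PowerSeries.mk fun n => (C d p n : ℚ)

/-- Adding a direction to `I` means choosing `p` independent parts, which raises the series to the
`p`-th power. -/
theorem mk_ncard_compatibleDecs (hp : 2 ≤ p) (I : Finset (Fin d)) :
    (PowerSeries.mk fun n => ((compatibleDecs d p I n).ncard : ℚ)) =
      genFun d p ^ p ^ I.card := by
  induction I using Finset.induction_on with
  | empty => simp [genFun, C, decompositions_eq hp]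
  | insert i I hi ih =>
    rw [Finset.card_insert_of_notMem hi, pow_succ, pow_mul, ← ih]
    ext n
    rw [← Fintype.card_fin p, ← Finset.card_univ, ← Finset.prod_const, PowerSeries.coeff_prod]
    simp only [PowerSeries.coeff_mk, Finset.card_univ, Fintype.card_fin,
      ncard_compatibleDecs_insert hp hi]
    push_cast
    rfl

/-- The functional equation of the generating function, by inclusion-exclusion over the set of
possible directions of the first split. -/
theorem genFun_eq (hp : 2 ≤ p) : genFun d p = PowerSeries.X +
    ∑ i : Fin d, ((-1 : PowerSeries ℚ) ^ ((i : ℕ) + 1 + 1) *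
      (d.choose ((i : ℕ) + 1) : PowerSeries ℚ)) *
      genFun d p ^ p ^ ((i : ℕ) + 1) := by
  classical
  have key : genFun d p = PowerSeries.X + ∑ I ∈ (Finset.univ : Finset (Fin d)).powerset with
      I.Nonempty, (-1 : PowerSeries ℚ) ^ (I.card + 1) * genFun d p ^ p ^ I.card := by
    ext n
    have hie := Finset.inclusion_exclusion_card_biUnion (Finset.univ : Finset (Fin d))
      fun i => (compatibleDecs_finite hp {i} n).toFinset
    -- The trivial decomposition is compatible with no direction, so the union is disjoint; it
    -- accounts for the term `X`.
    have hU : (compatibleDecs d p ∅ n).ncard = (if n = 1 then 1 else 0) +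
        (Finset.univ.biUnion fun i : Fin d => (compatibleDecs_finite hp {i} n).toFinset).card := by
      rw [← Set.ncard_coe_finset]
      have hset : compatibleDecs d p ∅ n = (if n = 1 then {{unitCube d}} else ∅) ∪
          ↑(Finset.univ.biUnion fun i : Fin d => (compatibleDecs_finite hp {i} n).toFinset) := by
        refine Set.Subset.antisymm (fun S hS => ?_) (Set.union_subset ?_ ?_)
        · rcases compatibleDecs_empty_subset hp n hS with rfl | h
          · rw [if_pos (by simpa using hS.2.2.symm)]
            exact .inl rfl
          · exact .inr (by simpa using h)
        · split_ifs with hn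
          · rintro S rfl
            exact ⟨⟨_, .leaf⟩, by simp, by simp [hn]⟩
          · exact Set.empty_subset _
        · intro S hS
          simp only [Finset.coe_biUnion, Set.mem_iUnion, Set.Finite.coe_toFinset] at hS
          obtain ⟨i, _, hS⟩ := hS
          exact compatibleDecs_mono (Finset.empty_subset _) n hS
      rw [hset, Set.ncard_union_eq _ (by split_ifs <;> simp) (Finset.finite_toSet _)]
      · congr 1
        split_ifs <;> simp
      · refine Set.disjoint_left.2 fun S h1 h2 => ?_
        have h1 : S = {unitCube d} := by
          split_ifs at h1
          · exact h1
          · exact h1.elim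
        simp only [Finset.coe_biUnion, Set.mem_iUnion, Set.Finite.coe_toFinset] at h2
        obtain ⟨i, _, h2⟩ := h2
        exact not_compatible_unitCube hp i (h1 ▸ h2.2.1 i (Finset.mem_singleton_self i))
    -- The intersections in inclusion-exclusion are the families compatible with all of `I`.
    have hI : ∀ I : Finset (Fin d), ∀ hI : I.Nonempty,
        (I.inf' hI fun i => (compatibleDecs_finite hp {i} n).toFinset).card =
          (compatibleDecs d p I n).ncard := by
      intro I hI
      rw [← Set.ncard_coe_finset]
      congr 1
      ext S
      rw [Finset.mem_coe, ← Finset.singleton_subset_iff]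
      refine (Finset.le_inf'_iff _ _).trans ?_
      simp only [Finset.singleton_subset_iff, Set.Finite.mem_toFinset, compatibleDecs,
        Set.mem_ofPred_eq, Finset.mem_singleton, forall_eq]
      obtain ⟨i, hi⟩ := hI
      exact ⟨fun h => ⟨(h i hi).1, fun i hi => (h i hi).2.1, (h i hi).2.2⟩,
        fun h i hi => ⟨h.1, h.2.1 i hi, h.2.2⟩⟩
    simp only [hI] at hie
    rw [Finset.sum_coe_sort (s := Finset.univ.powerset.filter fun I : Finset (Fin d) => I.Nonempty)
      (f := fun I => (-1 : ℤ) ^ (I.card + 1) * ((compatibleDecs d p I n).ncard : ℤ))] at hie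
    have hie' := congrArg (Int.cast : ℤ → ℚ) hie
    rw [map_add, map_sum, genFun, PowerSeries.coeff_mk, C, decompositions_eq hp, hU, ← genFun,
      PowerSeries.coeff_X]
    push_cast at hie' ⊢
    rw [hie']
    congr 1
    refine Finset.sum_congr rfl fun I _ => ?_
    rw [← mk_ncard_compatibleDecs hp]
    rcases neg_one_pow_eq_or ℤ (I.card + 1) with h | h
    all_goals
      have h' := congrArg (Int.cast : ℤ → PowerSeries ℚ) h
      have h'' := congrArg (Int.cast : ℤ → ℚ) h
      push_cast at h' h''
      simp [h', h'']
  refine key.trans ?_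
  congr 1
  -- Group the subsets `I` by cardinality; the value 0 at `m = 0` discards the empty set.
  have := Finset.sum_powerset_apply_card (fun m : ℕ => if m = 0 then 0 else
    (-1 : PowerSeries ℚ) ^ (m + 1) * genFun d p ^ p ^ m) (x := (Finset.univ : Finset (Fin d)))
  rw [Finset.sum_range_succ', Finset.card_univ, Fintype.card_fin, ← Fin.sum_univ_eq_sum_range
    (fun m => d.choose (m + 1) • if m + 1 = 0 then 0 else
      (-1 : PowerSeries ℚ) ^ (m + 1 + 1) * genFun d p ^ p ^ (m + 1))] at this
  simp only [if_true, smul_zero, add_zero, Nat.succ_ne_zero, if_false] at this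
  rw [Finset.sum_filter]
  refine Eq.trans (Finset.sum_congr rfl fun I _ => ?_) (this.trans
    (Finset.sum_congr rfl fun i _ => ?_))
  · rw [← ite_not]
    simp [Finset.nonempty_iff_ne_empty]
  · rw [nsmul_eq_mul]
    ring

end CubeDecomposition

namespace CubeDecomposition

open PowerSeries

/-! ### Lagrange inversion -/

/-- Modulo `X ^ N`, the variable is a linear combination of powers of a polynomial of the form
`X * w` with `w 0 = 1`. -/
theorem exists_X_eq_sum_pow {w : Polynomial ℚ} (hw : w.coeff 0 = 1) (N : ℕ) :
    ∃ (a : ℕ → ℚ) (r : Polynomial ℚ), Polynomial.X =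
      ∑ k ∈ Finset.range N, Polynomial.C (a k) * (Polynomial.X * w) ^ k + Polynomial.X ^ N * r := by
  induction N with
  | zero => exact ⟨0, Polynomial.X, by simp⟩
  | succ N ih =>
    obtain ⟨a, r, h⟩ := ih
    -- Since `w` has constant term 1, subtracting `r(0) * w ^ N` kills the constant term of `r`; so
    -- `r(0)` is the next coefficient `a N`.
    have h0 : Polynomial.X ∣ r - Polynomial.C (r.coeff 0) * w ^ N := by
      rw [Polynomial.X_dvd_iff]
      rw [Polynomial.coeff_zero_eq_eval_zero] at hw
      simp [Polynomial.coeff_zero_eq_eval_zero, hw]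
    generalize r.coeff 0 = r0 at h0
    obtain ⟨q, hq⟩ := h0
    refine ⟨Function.update a N r0, q, ?_⟩
    rw [Finset.sum_range_succ, Function.update_self, Finset.sum_congr rfl fun k hk => by
      rw [Function.update_of_ne (Finset.mem_range.1 hk).ne]]
    calc Polynomial.X = _ := h
      _ = _ := by
        rw [sub_eq_iff_eq_add.1 hq]
        ring

/-- Substituting `f` for the variable turns `X * w` into `X`, so the identity becomes `f = ∑ a k X ^
k + f ^ N * r(f)`, and `X ^ N` divides `f ^ N`. -/
theorem coeff_eq_of_X_eq_sum_pow {w : Polynomial ℚ} {f : ℚ⟦X⟧} (hf0 : constantCoeff f = 0)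
    (hf : Polynomial.aeval f (Polynomial.X * w) = X) {N : ℕ} {a : ℕ → ℚ} {r : Polynomial ℚ}
    (h : Polynomial.X = ∑ k ∈ Finset.range N, Polynomial.C (a k) * (Polynomial.X * w) ^ k +
      Polynomial.X ^ N * r) {k : ℕ} (hk : k < N) : coeff k f = a k := by
  obtain ⟨f', rfl⟩ := X_dvd_iff.2 hf0
  have h1 := congrArg (Polynomial.aeval (X * f')) h
  simp only [map_add, map_sum, map_mul (Polynomial.aeval (X * f')) _ (_ ^ _),
    map_mul (Polynomial.aeval (X * f')) _ r, map_pow, hf, Polynomial.aeval_X,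
    Polynomial.aeval_C] at h1
  rw [h1, map_add, map_sum, mul_pow, mul_assoc, coeff_X_pow_mul', if_neg (by omega), add_zero,
    Finset.sum_eq_single k]
  · simp
  · intro l _ hl
    simp [coeff_X_pow, hl.symm]
  · intro h
    simp [hk] at h

/-- With `g = X * w`, this is the residue of `g' / g ^ (m + 1)`: it is 1 for `m = 0`, and for `m >
0` it vanishes because the form is the derivative of `-g ^ (-m) / m`. -/
theorem coeff_pow_succ_mul_derivative {v w : ℚ⟦X⟧} (hvw : v * w = 1) (m : ℕ) :
    coeff m (v ^ (m + 1) * d⁄dX ℚ (X * w)) = if m = 0 then 1 else 0 := by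
  have h1 : v ^ (m + 1) * d⁄dX ℚ (X * w) = v ^ m + X * (v ^ (m + 1) * d⁄dX ℚ w) := by
    rw [Derivation.leibniz, derivative_X, smul_eq_mul, smul_eq_mul]
    linear_combination v ^ m * hvw
  rw [h1, map_add]
  cases m with
  | zero =>
    simp
  | succ m =>
    have h2 : d⁄dX ℚ v = -(v ^ 2 * d⁄dX ℚ w) := by
      have h := congrArg (d⁄dX ℚ) hvw
      rw [Derivation.leibniz, smul_eq_mul, smul_eq_mul, derivative_one] at h
      linear_combination v * h - d⁄dX ℚ v * hvw
    have h3 : d⁄dX ℚ (v ^ (m + 1)) = -(((m + 1 : ℕ) : ℚ) • (v ^ (m + 1 + 1) * d⁄dX ℚ w)) := by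
      rw [derivative_pow, h2, smul_eq_C_mul]
      simp
      ring
    have h4 := congrArg (coeff m) h3
    rw [coeff_derivative, map_neg, coeff_smul] at h4
    have hm : ((m : ℚ) + 1) ≠ 0 := by positivity
    rw [coeff_succ_X_mul, if_neg m.succ_ne_zero]
    apply mul_right_cancel₀ hm
    push_cast [smul_eq_mul] at h4
    linear_combination h4

/-- **Lagrange inversion** for the compositional inverse of a polynomial `X * w` with `w 0 = 1`. -/
theorem lagrange_inversion {w : Polynomial ℚ} (hw : w.coeff 0 = 1) {f v : ℚ⟦X⟧}
    (hf0 : constantCoeff f = 0) (hf : Polynomial.aeval f (Polynomial.X * w) = X)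
    (hvw : v * w = 1) (n : ℕ) : ((n + 1 : ℕ) : ℚ) * coeff (n + 1) f = coeff n (v ^ (n + 1)) := by
  -- Order `n + 2` keeps the term `k = n + 1`, and the derivative of the remainder is still
  -- divisible by `X ^ (n + 1)`.
  obtain ⟨a, r, h⟩ := exists_X_eq_sum_pow hw (n + 2)
  have ha := fun k (hk : k < n + 2) => coeff_eq_of_X_eq_sum_pow hf0 hf h hk
  -- Differentiate the expansion of `X`, multiply by `v ^ (n + 1)` and compare coefficients of `X ^
  -- n`: by the residue computation only `k = n + 1` survives.
  have h1 := congrArg (fun q : Polynomial ℚ => d⁄dX ℚ (Polynomial.coeToPowerSeries.ringHom q)) h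
  simp only [map_sum, map_add, map_mul, map_pow, Polynomial.coeToPowerSeries.ringHom_apply,
    Polynomial.coe_X, Polynomial.coe_C] at h1
  have h2 := congrArg (fun q => coeff n (v ^ (n + 1) * q)) h1
  simp only [derivative_X, mul_one, mul_add, map_add, Finset.mul_sum, map_sum] at h2
  have hterm : ∀ k ∈ Finset.range (n + 2),
      coeff n (v ^ (n + 1) * d⁄dX ℚ (PowerSeries.C (a k) * (X * (w : ℚ⟦X⟧)) ^ k)) =
        if k = n + 1 then ((n + 1 : ℕ) : ℚ) * a k else 0 := by
    intro k hk
    cases k with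
    | zero => simp
    | succ k =>
      obtain ⟨m, rfl⟩ : ∃ m, n = k + m := ⟨n - k, by have := Finset.mem_range.1 hk; omega⟩
      have h3 : v ^ (k + m + 1) * d⁄dX ℚ (PowerSeries.C (a (k + 1)) * (X * (w : ℚ⟦X⟧)) ^ (k + 1)) =
          PowerSeries.C (((k + 1 : ℕ) : ℚ) * a (k + 1)) *
            (X ^ k * (v ^ (m + 1) * d⁄dX ℚ (X * (w : ℚ⟦X⟧)))) := by
        rw [Derivation.leibniz, derivative_pow, derivative_C, smul_zero, add_zero,
          map_mul PowerSeries.C, map_natCast PowerSeries.C, smul_eq_mul, Nat.add_sub_cancel]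
        have h4 : (v * (w : ℚ⟦X⟧)) ^ k = 1 := by rw [hvw, one_pow]
        rw [mul_pow] at h4
        generalize d⁄dX ℚ (X * (w : ℚ⟦X⟧)) = D
        linear_combination (PowerSeries.C (a (k + 1)) * ((k + 1 : ℕ) : ℚ⟦X⟧) * X ^ k *
          v ^ (m + 1) * D) * h4
      rw [h3, coeff_C_mul, add_comm k m, coeff_X_pow_mul, coeff_pow_succ_mul_derivative hvw]
      by_cases hm : m = 0
      · simp [hm]
      · rw [if_neg hm, if_neg (by omega), mul_zero]
  rw [h2, Finset.sum_congr rfl hterm, Finset.sum_ite_eq', if_pos (by simp), ha _ (by omega),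
    Derivation.leibniz, derivative_pow, derivative_X]
  simp only [smul_eq_mul, mul_one, Nat.add_succ_sub_one]
  have h5 : v ^ (n + 1) * (X ^ (n + 2) * d⁄dX ℚ (r : ℚ⟦X⟧) +
      (r : ℚ⟦X⟧) * (((n + 2 : ℕ) : ℚ⟦X⟧) * X ^ (n + 1))) = X ^ (n + 1) * (v ^ (n + 1) *
      (X * d⁄dX ℚ (r : ℚ⟦X⟧) + (r : ℚ⟦X⟧) * ((n + 2 : ℕ) : ℚ⟦X⟧))) := by
    ring
  rw [h5, coeff_X_pow_mul', if_neg (by omega), add_zero]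

/-! ### Expansion into multinomial coefficients -/

theorem multinomial_cons_univ {d : ℕ} (m : ℕ) (t : Fin d → ℕ) :
    Nat.multinomial Finset.univ (Fin.cons m t : Fin (d + 1) → ℕ) =
      (m + ∑ i, t i).choose m * Nat.multinomial Finset.univ t := by
  have h1 := Nat.multinomial_spec Finset.univ (Fin.cons m t : Fin (d + 1) → ℕ)
  have h2 := Nat.multinomial_spec Finset.univ t
  have h3 := Nat.add_choose_mul_factorial_mul_factorial m (∑ i, t i)
  simp only [Fin.prod_univ_succ, Fin.sum_univ_succ, Fin.cons_zero, Fin.cons_succ] at h1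
  have hpos : 0 < m.factorial * ∏ i, (t i).factorial :=
    Nat.mul_pos m.factorial_pos (Finset.prod_pos fun i _ => (t i).factorial_pos)
  refine Nat.eq_of_mul_eq_mul_left hpos ?_
  rw [h1, ← h3, ← h2, ← Nat.choose_symm_add]
  ring

/-- The binomial series of a negative exponent. -/
theorem coeff_pow_of_mul_one_sub_eq_one {u v : ℚ⟦X⟧} (hu : X ∣ u) (huv : v * (1 - u) = 1)
    (m : ℕ) : coeff m (v ^ (m + 1)) =
      ∑ s ∈ Finset.range (m + 1), ((m + s).choose m : ℚ) * coeff m (u ^ s) := by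
  set B : ℚ⟦X⟧ := mk fun s => ((m + s).choose m : ℚ) with hB
  -- `B` is `(1 - X) ^ (-(m + 1))`. Its truncation is a polynomial inverse modulo `X ^ (m + 1)`, so
  -- `u` can be substituted by `aeval`; the error is divisible by `u ^ (m + 1)`, hence by `X ^ (m +
  -- 1)`.
  have hB1 : B * (1 - X) ^ (m + 1) = 1 := mk_add_choose_mul_one_sub_pow_eq_one ℚ m
  have hdvd : (Polynomial.X : Polynomial ℚ) ^ (m + 1) ∣
      trunc (m + 1) B * (1 - Polynomial.X) ^ (m + 1) - 1 := by
    rw [Polynomial.X_pow_dvd_iff]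
    intro k hk
    have h1 := eq_X_pow_mul_shift_add_trunc (m + 1) B
    rw [← Polynomial.coeff_coe]
    have h2 : ((trunc (m + 1) B * (1 - Polynomial.X) ^ (m + 1) - 1 : Polynomial ℚ) : ℚ⟦X⟧) =
        X ^ (m + 1) * (-(mk fun i => coeff (i + (m + 1)) B) * (1 - X) ^ (m + 1)) := by
      push_cast
      linear_combination hB1 - (1 - X) ^ (m + 1) * h1
    rw [h2, coeff_X_pow_mul', if_neg (by omega)]
  obtain ⟨q, hq⟩ := hdvd
  have h1 := congrArg (Polynomial.aeval u) hq
  simp only [map_sub, map_mul, map_pow, map_one, Polynomial.aeval_X] at h1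
  have h2 : v ^ (m + 1) = Polynomial.aeval u (trunc (m + 1) B) -
      u ^ (m + 1) * (Polynomial.aeval u q * v ^ (m + 1)) := by
    have h3 : v ^ (m + 1) * (1 - u) ^ (m + 1) = 1 := by rw [← mul_pow, huv, one_pow]
    linear_combination (-v ^ (m + 1)) * h1 + Polynomial.aeval u (trunc (m + 1) B) * h3
  obtain ⟨u', rfl⟩ := hu
  rw [h2, map_sub, mul_pow, mul_assoc, coeff_X_pow_mul', if_neg (by omega), sub_zero,
    Polynomial.aeval_eq_sum_range' (natDegree_trunc_lt B m), map_sum]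
  refine Finset.sum_congr rfl fun s hs => ?_
  rw [coeff_smul, coeff_trunc, if_pos (Finset.mem_range.1 hs), hB, coeff_mk, smul_eq_mul]

theorem coeff_sum_pow {d : ℕ} (c : Fin d → ℚ) (e : Fin d → ℕ) (m s : ℕ) :
    coeff m ((∑ i, PowerSeries.C (c i) * (X : ℚ⟦X⟧) ^ e i) ^ s) =
      ∑ t ∈ (Finset.univ.piAntidiag s : Finset (Fin d → ℕ)) with ∑ i, t i * e i = m,
        (Nat.multinomial Finset.univ t : ℚ) * ∏ i, c i ^ t i := by
  rw [Finset.sum_pow_eq_sum_piAntidiag, map_sum, Finset.sum_filter]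
  refine Finset.sum_congr rfl fun t _ => ?_
  simp only [mul_pow, ← pow_mul, Finset.prod_mul_distrib, Finset.prod_pow_eq_pow_sum, ← map_pow,
    ← map_prod]
  rw [← map_natCast (PowerSeries.C (R := ℚ)), ← mul_assoc, ← map_mul, coeff_C_mul, coeff_X_pow]
  simp only [mul_comm (e _), mul_ite, mul_one, mul_zero, eq_comm]

/-- The tuples `t` are grouped by `s = ∑ t_i`, where `s ≤ m` because all exponents `p ^ k - 1` are
at least 1. The factor `choose (m + s) m` merges with the multinomial coefficient of `t` into that
of `(m, t)`. -/
theorem coeff_pow_of_mul_one_sub_sum_eq_one {d p : ℕ} (hp : 2 ≤ p) (c : Fin d → ℚ) {v : ℚ⟦X⟧}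
    (hv : v * (1 - ∑ i : Fin d, PowerSeries.C (c i) * X ^ (p ^ ((i : ℕ) + 1) - 1)) = 1) (m : ℕ) :
    coeff m (v ^ (m + 1)) = ∑ t ∈ exponents d p (m + 1),
      (Nat.multinomial Finset.univ (Fin.cons m t : Fin (d + 1) → ℕ) : ℚ) * ∏ i, c i ^ t i := by
  have he : ∀ i : Fin d, 1 ≤ p ^ ((i : ℕ) + 1) - 1 := fun i => by
    have : 1 < p ^ ((i : ℕ) + 1) := Nat.one_lt_pow (Nat.succ_ne_zero _) (by omega)
    omega
  have hdvd : (X : ℚ⟦X⟧) ∣ ∑ i : Fin d, PowerSeries.C (c i) * X ^ (p ^ ((i : ℕ) + 1) - 1) :=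
    Finset.dvd_sum fun i _ => Dvd.dvd.mul_left (dvd_pow_self X (by have := he i; omega)) _
  rw [coeff_pow_of_mul_one_sub_eq_one hdvd hv]
  have hmaps : ∀ t ∈ exponents d p (m + 1), ∑ i, t i ∈ Finset.range (m + 1) := by
    intro t ht
    rw [mem_exponents hp (by omega)] at ht
    have : ∑ i, t i ≤ ∑ i : Fin d, t i * (p ^ ((i : ℕ) + 1) - 1) :=
      Finset.sum_le_sum fun i _ => Nat.le_mul_of_pos_right _ (he i)
    rw [Finset.mem_range]
    omega
  rw [← Finset.sum_fiberwise_of_maps_to hmaps]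
  refine Finset.sum_congr rfl fun s _ => ?_
  rw [coeff_sum_pow, Finset.mul_sum]
  refine Finset.sum_congr ?_ fun t ht => ?_
  · ext t
    rw [Finset.mem_filter, Finset.mem_filter, mem_exponents hp (by omega)]
    simp [and_comm]
  · have hs : ∑ i, t i = s := (Finset.mem_filter.1 ht).2
    rw [multinomial_cons_univ, hs]
    push_cast
    ring

/-! ### Conclusion -/

theorem constantCoeff_genFun (d p : ℕ) : constantCoeff (genFun d p) = 0 := by
  have : decompositions d p 0 = ∅ := by
    refine Set.eq_empty_of_forall_notMem ?_
    rintro S ⟨m, hm, -⟩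
    omega
  rw [← coeff_zero_eq_constantCoeff_apply, genFun, coeff_mk, CubeDecomposition.C, this]
  simp

/-- The functional equation with one factor `F` taken out of each power `F ^ p ^ k`: it reads `F *
w(F) = X`. -/
theorem aeval_genFun {d p : ℕ} (hp : 2 ≤ p) :
    Polynomial.aeval (genFun d p) (Polynomial.X * (1 - ∑ i : Fin d, Polynomial.C
      ((-1 : ℚ) ^ ((i : ℕ) + 1 + 1) * (d.choose ((i : ℕ) + 1) : ℚ)) *
        Polynomial.X ^ (p ^ ((i : ℕ) + 1) - 1))) = X := by
  have h := genFun_eq (d := d) hp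
  simp only [map_mul, map_sub, map_sum, map_pow, Polynomial.aeval_X, map_one,
    map_neg, map_natCast, mul_sub, mul_one, Finset.mul_sum]
  rw [sub_eq_iff_eq_add]
  refine h.trans ?_
  congr 1
  refine Finset.sum_congr rfl fun i _ => ?_
  have : p ^ ((i : ℕ) + 1) = p ^ ((i : ℕ) + 1) - 1 + 1 :=
    (Nat.sub_add_cancel (Nat.one_le_pow _ _ (by omega))).symm
  conv_lhs => rw [this]
  ring

theorem C_eq_sum {d p n : ℕ} (hp : 2 ≤ p) (hn : 1 ≤ n) : (CubeDecomposition.C d p n : ℚ) =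
    1 / (n : ℚ) * ∑ t ∈ exponents d p n,
      (Nat.multinomial Finset.univ (Fin.cons (n - 1) t : Fin (d + 1) → ℕ) : ℚ) *
        ∏ i : Fin d, ((-1 : ℚ) ^ (t i * (((i : ℕ) + 1) + 1)) *
          (Nat.choose d ((i : ℕ) + 1) : ℚ) ^ (t i)) := by
  obtain ⟨m, rfl⟩ : ∃ m, n = m + 1 := ⟨n - 1, by omega⟩
  set c : Fin d → ℚ := fun i => (-1) ^ ((i : ℕ) + 1 + 1) * (d.choose ((i : ℕ) + 1) : ℚ) with hc
  set w : Polynomial ℚ :=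
    1 - ∑ i : Fin d, Polynomial.C (c i) * Polynomial.X ^ (p ^ ((i : ℕ) + 1) - 1) with hw
  have hw0 : w.coeff 0 = 1 := by
    rw [hw, Polynomial.coeff_sub, Polynomial.finsetSum_coeff, Finset.sum_eq_zero]
    · simp
    · intro i _
      have : 1 < p ^ ((i : ℕ) + 1) := Nat.one_lt_pow (Nat.succ_ne_zero _) (by omega)
      rw [Polynomial.coeff_C_mul, Polynomial.coeff_X_pow, if_neg (by omega), mul_zero]
  have hwc : (w : ℚ⟦X⟧) =
      1 - ∑ i : Fin d, PowerSeries.C (c i) * X ^ (p ^ ((i : ℕ) + 1) - 1) := by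
    rw [← Polynomial.coeToPowerSeries.ringHom_apply, hw]
    simp only [map_sub, map_one, map_sum, map_mul, map_pow,
      Polynomial.coeToPowerSeries.ringHom_apply, Polynomial.coe_X, Polynomial.coe_C]
  have hvw : (w : ℚ⟦X⟧)⁻¹ * (w : ℚ⟦X⟧) = 1 := by
    refine PowerSeries.inv_mul_cancel _ ?_
    rw [← coeff_zero_eq_constantCoeff_apply, Polynomial.coeff_coe, hw0]
    exact one_ne_zero
  have hL := lagrange_inversion hw0
    (constantCoeff_genFun d p) (aeval_genFun hp) hvw m
  rw [coeff_pow_of_mul_one_sub_sum_eq_one hp c (hwc ▸ hvw),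
    genFun, coeff_mk] at hL
  have hm : ((m + 1 : ℕ) : ℚ) ≠ 0 := by positivity
  rw [one_div, eq_inv_mul_iff_mul_eq₀ hm, hL]
  refine Finset.sum_congr rfl fun t _ => ?_
  rw [Nat.add_sub_cancel]
  congr 1
  refine Finset.prod_congr rfl fun i _ => ?_
  rw [hc, mul_pow, ← pow_mul, mul_comm (t i)]

end CubeDecomposition

theorem theorem4 (d p n : ℕ) (hd : 1 ≤ d) (hp : 2 ≤ p) (hn : 1 ≤ n) :
    (CubeDecomposition.decompositions d p n).Finite ∧
    (CubeDecomposition.C d p n : ℚ) =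
      1 / (n : ℚ) * ∑ t ∈ CubeDecomposition.exponents d p n,
        (Nat.multinomial Finset.univ (Fin.cons (n - 1) t : Fin (d + 1) → ℕ) : ℚ) *
          ∏ i : Fin d, ((-1 : ℚ) ^ (t i * (((i : ℕ) + 1) + 1)) *
            (Nat.choose d ((i : ℕ) + 1) : ℚ) ^ (t i)) := by
  exact ⟨CubeDecomposition.decompositions_eq hp n ▸
    CubeDecomposition.compatibleDecs_finite hp ∅ n, CubeDecomposition.C_eq_sum hp hn⟩
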